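/- Notation. Let $N=2^m$ with $m\ge 0$ an integer, let $\omega_N=e^{-2\pi i/N}$, and for real inputs $x_0,\dots,x_{N-1}$ let $$C_k=2\sum_{n=0}^{N-1}x_n\cos\Bigl[\frac{\pi}{N}\bigl(n+\tfrac12\bigr)k\Bigr],\qquad 0\le k<N,$$ be their type-II discrete cosine transform (DCT-II). For powers of two $N$ define the scale factors $s_{N,k}$ by $s_{N,k}=1$ for $N\le 4$ and, for $N>4$ and $k_4=k\bmod (N/4)$, $$s_{N,k}=s_{N/4,k_4}\cos(2\pi k_4/N)\ \text{ if } k_4\le N/8,\qquad s_{N,k}=s_{N/4,k_4}\sin(2\pi k_4/N)\ \text{ otherwise},$$ and put $t_{N,k}=\omega_N^k\,s_{N/4,k}/s_{N,k}$. Scaled FFT. For $\ell\in\{1,2,4\}$, let $\mathrm{FFT}^{(\ell)}_N$ be the following recursive algorithm, which takes $N=2^m$ real inputs and computes, for $0\le k\le N/2$, the numbers $X_k=\frac{1}{s_{\ell N,k}}\sum_{n}x_n\omega_N^{nk}$. For $N\ge 4$, let $U$ be the output of $\mathrm{FFT}^{(\ell')}_{N/2}$ on $(x_{2n})$, with $\ell'=2,4,2$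 for $\ell=1,2,4$ respectively, and let $Z$ and $Z'$ be the outputs of $\mathrm{FFT}^{(1)}_{N/4}$ on $(x_{4n+1})$ and on $(x_{4n-1})$ (indices modulo $N$). For $0\le k\le N/8$ let $P=t_{N,k}Z_k+t_{N,k}^*Z'_k$ and $M=t_{N,k}Z_k-t_{N,k}^*Z'_k$. For $\ell=1,2$, $$X_k=U_k+P\tfrac{s_{N,k}}{s_{\ell N,k}},\quad X_{N/2-k}=U_k^*-P^*\tfrac{s_{N,k}}{s_{\ell N,k}},\quad X_{N/4+k}=U_{N/4-k}^*-iM\tfrac{s_{N,k}}{s_{\ell N,k+N/4}},\quad X_{N/4-k}=U_{N/4-k}-iM^*\tfrac{s_{N,k}}{s_{\ell N,k+N/4}},$$ and for $\ell=4$, each of $U_k+P$, $U_k^*-P^*$, $U_{N/4-k}^*-iM$, $U_{N/4-k}-iM^*$ is computed first and then multiplied by $s_{N,k}/s_{4N,j}$, where $j=k,\ N/2-k,\ N/4+k,\ N/4-k$ is its output index. For $k=0$ and $k=N/8$ (where $t_{N,k}=1$ and $t_{N,k}=1-i$, some operands are real, and outputs coincide) and for $N=1,2$, operations on known zero imaginary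 parts, multiplications by $\pm1$ and $\pm i$, and repeated computations are omitted. Cost model. Count real additions (including subtractions) and real multiplications by precomputed constants; the two together are flops. Sign changes are absorbed into additions and subtractions. A real constant times a complex number costs 2 multiplications; a general complex constant times a complex number costs 4 multiplications and 2 additions; a constant of the form $1\pm i\tau$ with $\tau$ real, times a complex number, costs 2 multiplications and 2 additions. New DCT-II algorithm. Put $\tilde y_n=x_{2n}$ for $0\le 2n<N$ and $\tilde y_{N-1-n}=x_{2n+1}$ for $0\le n<N/2$ with $2n+1<N$; compute $Z=\mathrm{FFT}^{(1)}_N(\tilde y)$; output $C_0=2Z_0$, and $C_k=\mathrm{Re}(2\omega_{4N}^ks_{N,k}Z_k)$ and $C_{N-k}=-\mathrm{Im}(2\omega_{4N}^ks_{N,k}Z_k)$ for $0<k<N/2$, and (if $N>1$) $C_{N/2}=\sqrt2\,Z_{N/2}$. Scaled DCT-II algorithm. The same, except that each factor $2\omega_{4N}^ks_{N,k}$ is replaced by $t_{4N,k}$ and the outputs with indices $0$ and $N/2$ are $Z_0$ and $Z_{N/2}$. Theorem. For every $N=2^m$, $m\ge 0$, and all real inputs: 1. the new DCT-II algorithm computes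 $C_k$, $0\le k<N$; 2. $s_{4N,k}>0$, and the scaled DCT-II algorithm computes $C_k/(2s_{4N,k})$, $0\le k<N$; 3. the scaled algorithm uses exactly $N$ real multiplications fewer than the new DCT-II algorithm, and the same number of real additions. In particular, for $N=8$ the new DCT-II algorithm uses 42 flops and the scaled algorithm saves 8 multiplications, using 34 flops (the saving of Arai et al.). -/

import Mathlib

namespace ScaledDCT

/-! ### Straight-line real arithmetic with operation counts -/

/-- A program over registers of type `R` returning a result of type `α`. Its only arithmetic
instructions are: the sum of two registers, the difference of two registers, and the product of a
register with a real constant that is known in advance. The algorithms below are written for an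
arbitrary register type `R`, so that they can act on data only through these instructions. -/
inductive Prog (R α : Type) : Type where
  | ret (a : α) : Prog R α
  | add (x y : R) (k : R → Prog R α) : Prog R α
  | sub (x y : R) (k : R → Prog R α) : Prog R α
  | mul (c : ℝ) (x : R) (k : R → Prog R α) : Prog R α

namespace Prog

/-- Sequential composition. -/
def bind {R α β : Type} : Prog R α → (α → Prog R β) → Prog R β
  | ret a, f => f a
  | add x y k, f => add x y (fun r => bind (k r) f)
  | sub x y k, f => sub x y (fun r => bind (k r) f)
  | mul c x k, f => mul c x (fun r => bind (k r) f)

instance instMonad {R : Type} : Monad (Prog R) where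
  pure := ret
  bind := bind

/-- The result of running a program on real data. -/
noncomputable def eval {α : Type} : Prog ℝ α → α
  | ret a => a
  | add x y k => eval (k (x + y))
  | sub x y k => eval (k (x - y))
  | mul c x k => eval (k (c * x))

/-- The number of real additions and subtractions executed. -/
noncomputable def adds {α : Type} : Prog ℝ α → ℕ
  | ret _ => 0
  | add x y k => adds (k (x + y)) + 1
  | sub x y k => adds (k (x - y)) + 1
  | mul c x k => adds (k (c * x))

/-- The number of real multiplications executed. -/
noncomputable def mults {α : Type} : Prog ℝ α → ℕ
  | ret _ => 0
  | add x y k => mults (k (x + y))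
  | sub x y k => mults (k (x - y))
  | mul c x k => mults (k (c * x)) + 1

/-- The number of flops: real additions plus real multiplications. -/
noncomputable def flops {α : Type} (p : Prog ℝ α) : ℕ := p.adds + p.mults

/-- One addition. -/
def radd {R : Type} (x y : R) : Prog R R := add x y ret

/-- One subtraction. -/
def rsub {R : Type} (x y : R) : Prog R R := sub x y ret

/-- One multiplication by a constant. -/
def rmul {R : Type} (c : ℝ) (x : R) : Prog R R := mul c x ret

/-- Run `f 0, …, f (n - 1)` one after the other and tabulate the results (`d` elsewhere). -/
def loop {R α : Type} (d : α) (f : ℕ → Prog R α) : ℕ → Prog R (ℕ → α)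
  | 0 => pure (fun _ => d)
  | n + 1 => do
    let g ← loop d f n
    let a ← f n
    pure (Function.update g n a)

end Prog

open Prog

/-- A complex number held in two real registers. -/
structure Cx (R : Type) where
  re : R
  im : R

/-- A register pair that holds the complex number `0`. -/
def Cx.zero {R : Type} [Zero R] : Cx R := ⟨0, 0⟩

/-- Multiplication of a complex number by a real constant: 2 real multiplications. -/
def cscale {R : Type} (c : ℝ) (z : Cx R) : Prog R (Cx R) := do
  let a ← rmul c z.re
  let b ← rmul c z.im
  pure ⟨a, b⟩

/-- The real and the negated imaginary part of `w z`, for a general complex constant `w`: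
4 real multiplications and 2 additions. -/
def cmulConj {R : Type} (w : ℂ) (z : Cx R) : Prog R (Cx R) := do
  let a ← rmul w.re z.re
  let b ← rmul w.im z.im
  let c ← rmul (-w.im) z.re
  let d ← rmul w.re z.im
  let u ← rsub a b
  let v ← rsub c d
  pure ⟨u, v⟩

/-- Multiplication by a complex constant `t` of the special form `1 + i τ`:
2 real multiplications and 2 additions. -/
def cmulUnitRe {R : Type} (t : ℂ) (z : Cx R) : Prog R (Cx R) := do
  let b ← rmul t.im z.im
  let d ← rmul t.im z.re
  let u ← rsub z.re b
  let v ← radd z.im d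
  pure ⟨u, v⟩

/-- The real and the negated imaginary part of `t z`, for a complex constant `t` of the special
form `1 + i τ`: 2 real multiplications and 2 additions. -/
def cmulUnitReConj {R : Type} (t : ℂ) (z : Cx R) : Prog R (Cx R) := do
  let b ← rmul t.im z.im
  let c ← rmul (-t.im) z.re
  let u ← rsub z.re b
  let v ← rsub c z.im
  pure ⟨u, v⟩

/-! ### Constants -/

/-- `ω_N = exp(-2πi/N)`. -/
noncomputable def dftRoot (N : ℕ) : ℂ := Complex.exp (-2 * Real.pi * Complex.I / N)

/-- The scale factor `s_{N,k}` (for `N` a power of two). -/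
noncomputable def s (N k : ℕ) : ℝ :=
  if _h : N ≤ 4 then 1
  else if k % (N / 4) ≤ N / 8 then
    s (N / 4) (k % (N / 4)) * Real.cos (2 * Real.pi * (k % (N / 4) : ℕ) / N)
  else
    s (N / 4) (k % (N / 4)) * Real.sin (2 * Real.pi * (k % (N / 4) : ℕ) / N)
termination_by N
decreasing_by all_goals omega

/-- The scaled twiddle factor `t_{N,k} = ω_N^k s_{N/4,k} / s_{N,k}`. It has real part `1` for
`0 ≤ k ≤ N/8`, which is the only range in which it is used. -/
noncomputable def t (N k : ℕ) : ℂ := dftRoot N ^ k * ((s (N / 4) k / s N k : ℝ) : ℂ)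

/-! ### The rescaled conjugate-pair split-radix FFT for real inputs -/

/-- The index `ℓ ∈ {1, 2, 4}` of the mutually recursive subroutines; the one with index `ℓ`
computes the DFT of size `N` divided by `s_{ℓN,k}`. -/
inductive Scale : Type where
  | one
  | two
  | four

/-- The subroutine that is called for the half-size subtransform. -/
def Scale.sub : Scale → Scale
  | .one => .two
  | .two => .four
  | .four => .two

/-- The pair `t Z + t* Z'`, `t* Z' - t Z`, for `t = t_{N,k}` with `0 < k < N/8`. -/
noncomputable def twiddle {R : Type} (N k : ℕ) (z z' : Cx R) : Prog R (Cx R × Cx R) := do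
  let a ← cmulUnitRe (t N k) z
  let b ← cmulUnitRe (star (t N k)) z'
  let pr ← radd a.re b.re
  let pi ← radd a.im b.im
  let qr ← rsub b.re a.re
  let qi ← rsub b.im a.im
  pure (⟨pr, pi⟩, ⟨qr, qi⟩)

/-- The loop body for `0 < k < N/8`: from `U_k`, `U_{N/4-k}`, `Z_k`, `Z'_k` it computes
`X_k`, `X_{N/4-k}`, `X_{N/4+k}`, `X_{N/2-k}`. -/
noncomputable def bodyGeneric {R : Type} (N k : ℕ) (ℓ : Scale) (u v z z' : Cx R) :
    Prog R (Cx R × Cx R × Cx R × Cx R) := do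
  let pq ← twiddle N k z z'
  let p ← match ℓ with
    | .two => cscale (s N k / s (2 * N) k) pq.1
    | _ => pure pq.1
  let q ← match ℓ with
    | .two => cscale (s N k / s (2 * N) (k + N / 4)) pq.2
    | _ => pure pq.2
  let ar ← radd u.re p.re
  let ai ← radd u.im p.im
  let br ← radd v.re q.im
  let bi ← radd v.im q.re
  let cr ← rsub v.re q.im
  let ci ← rsub q.re v.im
  let dr ← rsub u.re p.re
  let di ← rsub p.im u.im
  match ℓ with
  | .four => do
    let a ← cscale (s N k / s (4 * N) k) ⟨ar, ai⟩
    let b ← cscale (s N k / s (4 * N) (N / 4 - k)) ⟨br, bi⟩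
    let c ← cscale (s N k / s (4 * N) (k + N / 4)) ⟨cr, ci⟩
    let d ← cscale (s N k / s (4 * N) (N / 2 - k)) ⟨dr, di⟩
    pure (a, b, c, d)
  | _ => pure (⟨ar, ai⟩, ⟨br, bi⟩, ⟨cr, ci⟩, ⟨dr, di⟩)

/-- The loop body for `k = 0`, where `t_{N,0} = s_{N,0} = 1` and `U_0`, `U_{N/4}`, `Z_0`, `Z'_0`
are real: it computes `X_0`, `X_{N/4}`, `X_{N/2}`. -/
noncomputable def bodyZero {R : Type} [Zero R] (N : ℕ) (ℓ : Scale) (u v z z' : R) :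
    Prog R (Cx R × Cx R × Cx R) := do
  let p ← radd z z'
  let q ← rsub z' z
  let a ← radd u p
  let d ← rsub u p
  match ℓ with
  | .one => pure (⟨a, 0⟩, ⟨v, q⟩, ⟨d, 0⟩)
  | .two => do
    let q ← rmul (1 / s (2 * N) (N / 4)) q
    pure (⟨a, 0⟩, ⟨v, q⟩, ⟨d, 0⟩)
  | .four => do
    let b ← cscale (1 / s (4 * N) (N / 4)) ⟨v, q⟩
    let d ← rmul (1 / s (4 * N) (N / 2)) d
    pure (⟨a, 0⟩, b, ⟨d, 0⟩)

/-- The loop body for `k = N/8`, where `t_{N,N/8} = 1 - i` and `Z_{N/8}`, `Z'_{N/8}` are real: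
it computes `X_{N/8}`, `X_{3N/8}`. -/
noncomputable def bodyEighth {R : Type} (N : ℕ) (ℓ : Scale) (u : Cx R) (z z' : R) :
    Prog R (Cx R × Cx R) := do
  let pr ← radd z z'
  let pi ← rsub z' z
  let p ← match ℓ with
    | .two => cscale (s N (N / 8) / s (2 * N) (N / 8)) ⟨pr, pi⟩
    | _ => pure ⟨pr, pi⟩
  let ar ← radd u.re p.re
  let ai ← radd u.im p.im
  let cr ← rsub u.re p.re
  let ci ← rsub p.im u.im
  match ℓ with
  | .four => do
    let a ← cscale (s N (N / 8) / s (4 * N) (N / 8)) ⟨ar, ai⟩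
    let c ← cscale (s N (N / 8) / s (4 * N) (3 * N / 8)) ⟨cr, ci⟩
    pure (a, c)
  | _ => pure (⟨ar, ai⟩, ⟨cr, ci⟩)

/-- The real-input FFT of size `N = 2^m`: from `x_0, …, x_{N-1}` it computes, for
`0 ≤ k ≤ N/2`, the `k`-th output of the DFT divided by `s_{ℓN,k}`. (The outputs `k = 0` and
`k = N/2` are real.) -/
noncomputable def rnsplitfft {R : Type} [Zero R] :
    (m : ℕ) → Scale → (ℕ → R) → Prog R (ℕ → Cx R)
  | 0, _, x => pure (fun _ => ⟨x 0, 0⟩)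
  | 1, ℓ, x => do
    let a ← radd (x 0) (x 1)
    let b ← rsub (x 0) (x 1)
    let b ← match ℓ with
      | .four => rmul (1 / s 8 1) b
      | _ => pure b
    pure (fun k => if k = 0 then ⟨a, 0⟩ else ⟨b, 0⟩)
  | m + 2, ℓ, x => do
    let N := 2 ^ (m + 2)
    let U ← rnsplitfft (m + 1) ℓ.sub (fun n => x (2 * n))
    let Z ← rnsplitfft m .one (fun n => x (4 * n + 1))
    let Z' ← rnsplitfft m .one (fun n => x ((4 * n + (N - 1)) % N))
    let A ← bodyZero N ℓ (U 0).re (U (N / 4)).re (Z 0).re (Z' 0).re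
    let B ← loop (Cx.zero, Cx.zero, Cx.zero, Cx.zero)
      (fun j => bodyGeneric N (j + 1) ℓ (U (j + 1)) (U (N / 4 - (j + 1))) (Z (j + 1)) (Z' (j + 1)))
      (N / 8 - 1)
    let E ← if N < 8 then pure (Cx.zero, Cx.zero)
      else bodyEighth N ℓ (U (N / 8)) (Z (N / 8)).re (Z' (N / 8)).re
    pure (fun k =>
      if k = 0 then A.1
      else if k < N / 8 then (B (k - 1)).1
      else if N = 8 * k then E.1
      else if k < N / 4 then (B (N / 4 - k - 1)).2.1
      else if k = N / 4 then A.2.1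
      else if k < 3 * N / 8 then (B (k - N / 4 - 1)).2.2.1
      else if 3 * N = 8 * k then E.2
      else if k < N / 2 then (B (N / 2 - k - 1)).2.2.2
      else A.2.2)

/-! ### The two DCT-II algorithms -/

/-- The type-II discrete cosine transform
`C_k = 2 ∑_{n=0}^{N-1} x_n cos((π/N) (n + 1/2) k)`. -/
noncomputable def dctII {N : ℕ} (x : Fin N → ℝ) (k : Fin N) : ℝ :=
  2 * ∑ n : Fin N, x n * Real.cos (Real.pi / N * ((n : ℕ) + 1 / 2) * (k : ℕ))

/-- The even-indexed inputs followed by the odd-indexed inputs in reverse order. -/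
def reorder {R : Type} [Zero R] {N : ℕ} (x : Fin N → R) (n : ℕ) : R :=
  if h : 2 * n < N then x ⟨2 * n, h⟩
  else if h : 2 * N - 1 - 2 * n < N then x ⟨2 * N - 1 - 2 * n, h⟩
  else 0

/-- The new DCT-II algorithm of size `N = 2^m`, where `Z` is the scaled FFT of the reordered input:
`C_0 = 2 Z_0`, `C_k = 2 Re(ω_{4N}^k s_{N,k} Z_k)` and `C_{N-k} = -2 Im(ω_{4N}^k s_{N,k} Z_k)` for
`0 < k < N/2`, and `C_{N/2} = √2 Z_{N/2}` (absent if `N = 1`). The factors `2 ω_{4N}^k s_{N,k}` are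
precomputed constants. -/
noncomputable def nsplitdctII {R : Type} [Zero R] :
    (m : ℕ) → (Fin (2 ^ m) → R) → Prog R (Fin (2 ^ m) → R)
  | 0, x => do
    let Z ← rnsplitfft 0 .one (reorder x)
    let c0 ← rmul 2 (Z 0).re
    pure (fun _ => c0)
  | m + 1, x => do
    let N := 2 ^ (m + 1)
    let Z ← rnsplitfft (m + 1) .one (reorder x)
    let c0 ← rmul 2 (Z 0).re
    let C ← loop Cx.zero
      (fun j => cmulConj (2 * dftRoot (4 * N) ^ (j + 1) * (s N (j + 1) : ℂ)) (Z (j + 1)))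
      (N / 2 - 1)
    let ch ← rmul (Real.sqrt 2) (Z (N / 2)).re
    pure (fun k =>
      if (k : ℕ) = 0 then c0
      else if (k : ℕ) < N / 2 then (C (k - 1)).re
      else if (k : ℕ) = N / 2 then ch
      else (C (N - k - 1)).im)

/-- The scaled DCT-II algorithm of size `N = 2^m`: as `nsplitdctII`, with each factor
`2 ω_{4N}^k s_{N,k}` replaced by `t_{4N,k}`, and with `C_0 = Z_0` and `C_{N/2} = Z_{N/2}`. -/
noncomputable def scaledNsplitdctII {R : Type} [Zero R] :
    (m : ℕ) → (Fin (2 ^ m) → R) → Prog R (Fin (2 ^ m) → R)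
  | 0, x => do
    let Z ← rnsplitfft 0 .one (reorder x)
    pure (fun _ => (Z 0).re)
  | m + 1, x => do
    let N := 2 ^ (m + 1)
    let Z ← rnsplitfft (m + 1) .one (reorder x)
    let C ← loop Cx.zero
      (fun j => cmulUnitReConj (t (4 * N) (j + 1)) (Z (j + 1)))
      (N / 2 - 1)
    pure (fun k =>
      if (k : ℕ) = 0 then (Z 0).re
      else if (k : ℕ) < N / 2 then (C (k - 1)).re
      else if (k : ℕ) = N / 2 then (Z (N / 2)).re
      else (C (N - k - 1)).im)

end ScaledDCT

/-! Write w = ω_{4N}^k · Y_k, with Y the unscaled DFT of the reordered input. A sample at even index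
2n sits at position n, where the phase (4n+1)k of w is exactly its cosine angle. A sample at odd
index 2n+1 sits at position N-1-n, where the angle is 2πk minus the cosine angle. Hence C_k = 2 Re
w. Conjugate symmetry for real data then gives C_{N-k} = -2 Im w, so one complex product yields two
outputs (`re_dftRoot_mul_dft`, `dctII_reflect`).

The FFT returns Y_k / s_{N,k}. Multiplying by 2 ω_{4N}^k s_{N,k} undoes the scaling; multiplying by
t_{4N,k} leaves w / s_{4N,k} instead. By `t_re` this second constant has real part 1, which saves
two multiplications in each of the N/2 - 1 products. The outputs 0 and N/2 save one each, so N > 1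
saves N in all; for N = 1 only output 0 occurs.

FFT correctness (`toC_rnsplitfft`) combines the conjugate-pair splitting `dft_split` with the period
N/4 and the reflection symmetry of s_{N,k} (`s_add_quarter`, `s_reflect`), which let the outputs of
a butterfly share scale factors. -/

namespace ScaledDCT

/-! ### Evaluation and cost of composite programs -/

namespace Prog

variable {α β : Type}

@[simp] lemma eval_pure (a : α) : (pure a : Prog ℝ α).eval = a := rfl
@[simp] lemma mults_pure (a : α) : (pure a : Prog ℝ α).mults = 0 := rfl
@[simp] lemma adds_pure (a : α) : (pure a : Prog ℝ α).adds = 0 := rfl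

@[simp] lemma eval_bind (p : Prog ℝ α) (f : α → Prog ℝ β) :
    (p >>= f).eval = (f p.eval).eval := by
  change (Prog.bind p f).eval = _
  induction p with
  | ret a => rfl
  | add x y k ih => exact ih _
  | sub x y k ih => exact ih _
  | mul c x k ih => exact ih _

@[simp] lemma mults_bind (p : Prog ℝ α) (f : α → Prog ℝ β) :
    (p >>= f).mults = p.mults + (f p.eval).mults := by
  change (Prog.bind p f).mults = _
  induction p with
  | ret a => simp [Prog.bind, mults, eval]
  | add x y k ih => exact ih _
  | sub x y k ih => exact ih _
  | mul c x k ih => simp only [Prog.bind, mults, eval, ih]; ring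

@[simp] lemma adds_bind (p : Prog ℝ α) (f : α → Prog ℝ β) :
    (p >>= f).adds = p.adds + (f p.eval).adds := by
  change (Prog.bind p f).adds = _
  induction p with
  | ret a => simp [Prog.bind, adds, eval]
  | add x y k ih => simp only [Prog.bind, adds, eval, ih]; ring
  | sub x y k ih => simp only [Prog.bind, adds, eval, ih]; ring
  | mul c x k ih => exact ih _

@[simp] lemma eval_radd (x y : ℝ) : (radd x y).eval = x + y := rfl
@[simp] lemma eval_rsub (x y : ℝ) : (rsub x y).eval = x - y := rfl
@[simp] lemma eval_rmul (x y : ℝ) : (rmul x y).eval = x * y := rfl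
@[simp] lemma mults_radd (x y : ℝ) : (radd x y).mults = 0 := rfl
@[simp] lemma mults_rsub (x y : ℝ) : (rsub x y).mults = 0 := rfl
@[simp] lemma mults_rmul (x y : ℝ) : (rmul x y).mults = 1 := rfl
@[simp] lemma adds_radd (x y : ℝ) : (radd x y).adds = 1 := rfl
@[simp] lemma adds_rsub (x y : ℝ) : (rsub x y).adds = 1 := rfl
@[simp] lemma adds_rmul (x y : ℝ) : (rmul x y).adds = 0 := rfl

lemma eval_loop (d : α) (f : ℕ → Prog ℝ α) (n : ℕ) {j : ℕ} (hj : j < n) :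
    (loop d f n).eval j = (f j).eval := by
  induction n with
  | zero => omega
  | succ n ih =>
    simp only [loop, eval_bind, eval_pure, Function.update_apply]
    split_ifs with h
    · rw [h]
    · exact ih (by omega)

/-- A uniform count is enough because the cost of every loop body used here depends neither on the
data nor on the constants. -/
lemma mults_loop (d : α) (f : ℕ → Prog ℝ α) (n c : ℕ) (h : ∀ j, (f j).mults = c) :
    (loop d f n).mults = n * c := by
  induction n with
  | zero => simp [loop]
  | succ n ih => simp only [loop, mults_bind, mults_pure, ih, h]; ring

lemma adds_loop (d : α) (f : ℕ → Prog ℝ α) (n c : ℕ) (h : ∀ j, (f j).adds = c) :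
    (loop d f n).adds = n * c := by
  induction n with
  | zero => simp [loop]
  | succ n ih => simp only [loop, adds_bind, adds_pure, ih, h]; ring

end Prog

open Prog

/-! ### Scale factors -/

lemma s_of_le {N : ℕ} (h : N ≤ 4) (k : ℕ) : s N k = 1 := by
  rw [s, dif_pos h]

lemma s_of_lt {N : ℕ} (h : 4 < N) (k : ℕ) : s N k =
    if k % (N / 4) ≤ N / 8 then
      s (N / 4) (k % (N / 4)) * Real.cos (2 * Real.pi * (k % (N / 4) : ℕ) / N)
    else s (N / 4) (k % (N / 4)) * Real.sin (2 * Real.pi * (k % (N / 4) : ℕ) / N) := by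
  rw [s, dif_neg (by omega)]

lemma s_add_quarter (N k : ℕ) : s N (k + N / 4) = s N k := by
  rcases le_or_gt N 4 with h | h
  · simp [s_of_le h]
  · simp [s_of_lt h]

lemma s_zero (N : ℕ) : s N 0 = 1 := by
  induction N using Nat.strong_induction_on with
  | _ N ih =>
    rcases le_or_gt N 4 with h | h
    · exact s_of_le h 0
    · simp [s_of_lt h, ih (N / 4) (by omega)]

/-- The reduced index lies in [0, N/4), so every angle lies in [0, π/2). The sine branch needs an
index above N/8, which excludes the zero angle. -/
lemma s_pos (N k : ℕ) : 0 < s N k := by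
  induction N using Nat.strong_induction_on generalizing k with
  | _ N ih =>
    rcases le_or_gt N 4 with h | h
    · simp [s_of_le h]
    · have hN : (0 : ℝ) < N := by positivity
      have hlt : k % (N / 4) < N / 4 := Nat.mod_lt _ (by omega)
      rw [s_of_lt h]
      generalize k % (N / 4) = j at hlt
      have h4 : (4 : ℝ) * j < N := by exact_mod_cast (by omega : 4 * j < N)
      have hb : 2 * Real.pi * j / N < Real.pi / 2 := by
        rw [div_lt_div_iff₀ hN two_pos]; nlinarith [Real.pi_pos]
      split_ifs with hj
      · refine mul_pos (ih _ (by omega) _) (Real.cos_pos_of_mem_Ioo ⟨?_, hb⟩)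
        have : 0 ≤ 2 * Real.pi * j / N := by positivity
        linarith [Real.pi_pos]
      · have hj0 : (0 : ℝ) < j := by exact_mod_cast (by omega : 0 < j)
        refine mul_pos (ih _ (by omega) _) (Real.sin_pos_of_pos_of_lt_pi (by positivity) ?_)
        linarith [Real.pi_pos]

lemma s_ne_zero (N k : ℕ) : s N k ≠ 0 := (s_pos N k).ne'

/-- The reflection symmetry of the scale factors. -/
lemma s_reflect (m : ℕ) {a b : ℕ} (h : 2 ^ m ≤ 4 ∨ 2 ^ m / 4 ∣ a + b) :
    s (2 ^ m) a = s (2 ^ m) b := by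
  induction m using Nat.strong_induction_on generalizing a b with
  | _ m ih =>
    rcases le_or_gt (2 ^ m) 4 with h4 | h4
    · rw [s_of_le h4, s_of_le h4]
    have hd := h.resolve_left (by omega)
    obtain ⟨n, rfl⟩ : ∃ n, m = n + 3 := by
      refine ⟨m - 3, ?_⟩
      have : 2 < m := (Nat.pow_lt_pow_iff_right (by norm_num : 1 < 2)).1 (by simpa using h4)
      omega
    have e8 : 2 ^ (n + 3) / 8 = 2 ^ n := by rw [pow_add]; omega
    have e4 : 2 ^ (n + 3) / 4 = 2 ^ (n + 1) := by rw [pow_add, pow_succ]; omega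
    have hp : 0 < 2 ^ n := by positivity
    -- The indices sum to N/4, so the angles are complementary and cosine becomes sine; the
    -- recursive factors agree by induction, as N/16 divides N/4 (or the smaller size is at most 4).
    have key : ∀ a' b' : ℕ, a' + b' = 2 ^ (n + 1) →
        s (2 ^ (n + 1)) a' * Real.cos (2 * Real.pi * a' / (2 ^ (n + 3) : ℕ)) =
        s (2 ^ (n + 1)) b' * Real.sin (2 * Real.pi * b' / (2 ^ (n + 3) : ℕ)) := by
      intro a' b' hab
      rw [ih (n + 1) (by omega) (a := a') (b := b'), ← Real.sin_pi_div_two_sub]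
      · congr 2
        have : (a' : ℝ) + b' = 2 ^ (n + 1) := by exact_mod_cast hab
        have hb : (a' : ℝ) = 2 ^ (n + 1) - b' := by linarith
        rw [hb]
        push_cast
        field_simp
        ring
      · rw [hab]
        rcases le_or_gt (2 ^ (n + 1)) 4 with h | h
        · exact Or.inl h
        · right
          obtain ⟨q, rfl⟩ : ∃ q, n = q + 1 := ⟨n - 1, by
            rcases n with _ | n
            · simp at h
            · omega⟩
          exact Nat.div_dvd_of_dvd ⟨2 ^ q, by ring⟩
    have hsum : (a % 2 ^ (n + 1) + b % 2 ^ (n + 1)) % 2 ^ (n + 1) = 0 := by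
      rw [← Nat.add_mod]; exact Nat.mod_eq_zero_of_dvd (e4 ▸ hd)
    have ha := Nat.mod_lt a (by positivity : 0 < 2 ^ (n + 1))
    have hb := Nat.mod_lt b (by positivity : 0 < 2 ^ (n + 1))
    rw [s_of_lt h4, s_of_lt h4, e4, e8]
    generalize a % 2 ^ (n + 1) = a' at *
    generalize b % 2 ^ (n + 1) = b' at *
    have h2 : 2 ^ (n + 1) = 2 * 2 ^ n := by ring
    obtain ⟨q, hq⟩ := Nat.dvd_of_mod_eq_zero hsum
    -- Both residues are below N/4 and their sum is a multiple of N/4.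
    have hcases : (a' = 0 ∧ b' = 0) ∨ a' + b' = 2 ^ (n + 1) := by
      have : q < 2 := by
        by_contra hq2
        have : 2 ^ (n + 1) * 2 ≤ 2 ^ (n + 1) * q := Nat.mul_le_mul_left _ (by omega)
        omega
      interval_cases q <;> omega
    rcases hcases with ⟨rfl, rfl⟩ | hab
    · rfl
    -- Residues summing to N/4 = 2 · (N/8) can both be at most N/8 only when equal, and cannot both
    -- exceed it.
    · split_ifs with h1 h3 h3
      · rw [show a' = b' by omega]
      · exact key a' b' hab
      · exact (key b' a' (by omega)).symm
      · omega

lemma s_eq_mul_cos {N k : ℕ} (hN : 4 < N) (hk : 8 * k ≤ N) :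
    s N k = s (N / 4) k * Real.cos (2 * Real.pi * k / N) := by
  rw [s_of_lt hN, Nat.mod_eq_of_lt (by omega), if_pos (by omega)]

/-! ### Roots of unity -/

lemma dftRoot_eq (N : ℕ) : dftRoot N = Complex.exp ((-(2 * Real.pi / N) : ℝ) * Complex.I) := by
  rw [dftRoot]; congr 1; push_cast; ring

lemma dftRoot_zpow (N : ℕ) (k : ℤ) :
    dftRoot N ^ k = Complex.exp ((-(2 * Real.pi * k / N) : ℝ) * Complex.I) := by
  rw [dftRoot_eq, ← Complex.exp_int_mul]; congr 1; push_cast; ring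

lemma dftRoot_ne_zero (N : ℕ) : dftRoot N ≠ 0 := Complex.exp_ne_zero _

lemma dftRoot_zpow_re (N : ℕ) (k : ℤ) :
    (dftRoot N ^ k).re = Real.cos (2 * Real.pi * k / N) := by
  rw [dftRoot_zpow, Complex.exp_ofReal_mul_I_re, Real.cos_neg]

lemma dftRoot_zpow_im (N : ℕ) (k : ℤ) :
    (dftRoot N ^ k).im = -Real.sin (2 * Real.pi * k / N) := by
  rw [dftRoot_zpow, Complex.exp_ofReal_mul_I_im, Real.sin_neg]

lemma star_dftRoot_zpow (N : ℕ) (k : ℤ) : star (dftRoot N ^ k) = dftRoot N ^ (-k) := by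
  apply Complex.ext
  · simp only [Complex.star_def, Complex.conj_re, dftRoot_zpow_re]
    rw [← Real.cos_neg]; congr 1; push_cast; ring
  · simp only [Complex.star_def, Complex.conj_im, dftRoot_zpow_im]
    rw [← Real.sin_neg]; congr 2; push_cast; ring

lemma dftRoot_zpow_self {N : ℕ} (hN : N ≠ 0) : dftRoot N ^ (N : ℤ) = 1 := by
  have : (N : ℝ) ≠ 0 := by exact_mod_cast hN
  apply Complex.ext
  · rw [dftRoot_zpow_re]; simp [this]
  · rw [dftRoot_zpow_im]; simp [this]

lemma dftRoot_quarter {M : ℕ} (hM : M ≠ 0) : dftRoot (4 * M) ^ (M : ℤ) = -Complex.I := by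
  have h : 2 * Real.pi * M / (4 * M : ℕ) = Real.pi / 2 := by
    have : (M : ℝ) ≠ 0 := by exact_mod_cast hM
    push_cast; field_simp; ring
  apply Complex.ext
  · rw [dftRoot_zpow_re, Int.cast_natCast, h]; simp
  · rw [dftRoot_zpow_im, Int.cast_natCast, h]; simp

lemma dftRoot_zpow_mul {a N : ℕ} (ha : a ≠ 0) (k : ℤ) :
    dftRoot (a * N) ^ (a * k) = dftRoot N ^ k := by
  rw [dftRoot_zpow, dftRoot_zpow]
  congr 4
  have : (a : ℝ) ≠ 0 := by exact_mod_cast ha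
  push_cast
  rcases eq_or_ne (N : ℝ) 0 with h | h
  · simp [h]
  · field_simp

/-- For k ≤ N/8 the quotient s_{N,k} / s_{N/4,k} is cos(2πk/N), the real part of ω_N^k. This is what
the scale factors are designed for. -/
lemma t_re {N k : ℕ} (hN : 4 < N) (hk : 8 * k ≤ N) : (t N k).re = 1 := by
  have h1 := dftRoot_zpow_re N k
  rw [zpow_natCast] at h1
  rw [t, Complex.re_mul_ofReal, h1, s_eq_mul_cos hN hk, Int.cast_natCast]
  have h2 := s_ne_zero N k
  rw [s_eq_mul_cos hN hk] at h2
  rw [mul_div_assoc', div_eq_one_iff_eq h2, mul_comm]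

/-! ### The discrete Fourier transform -/

/-- The discrete Fourier transform of size `N`, at an arbitrary integer frequency. -/
noncomputable def dft (N : ℕ) (x : ℕ → ℝ) (k : ℤ) : ℂ :=
  ∑ n ∈ Finset.range N, (x n : ℂ) * dftRoot N ^ (n * k)

lemma dft_add_size {N : ℕ} (hN : N ≠ 0) (x : ℕ → ℝ) (k : ℤ) :
    dft N x (k + N) = dft N x k := by
  refine Finset.sum_congr rfl fun n _ => ?_
  rw [mul_add, zpow_add₀ (dftRoot_ne_zero N), mul_comm (n : ℤ) (N : ℤ), zpow_mul _ (N : ℤ),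
    dftRoot_zpow_self hN, one_zpow, mul_one]

lemma star_dft (N : ℕ) (x : ℕ → ℝ) (k : ℤ) : star (dft N x k) = dft N x (-k) := by
  rw [dft, star_sum]
  refine Finset.sum_congr rfl fun n _ => ?_
  rw [star_mul', star_dftRoot_zpow, mul_neg]
  simp

lemma sum_range_four_mul (F : ℕ → ℂ) (M : ℕ) :
    ∑ n ∈ Finset.range (4 * M), F n = ∑ j ∈ Finset.range (2 * M), F (2 * j) +
      ∑ j ∈ Finset.range M, F (4 * j + 1) + ∑ j ∈ Finset.range M, F (4 * j + 3) := by
  induction M with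
  | zero => simp
  | succ M ih =>
    rw [show 4 * (M + 1) = 4 * M + 1 + 1 + 1 + 1 by ring,
      show 2 * (M + 1) = 2 * M + 1 + 1 by ring]
    simp only [Finset.sum_range_succ, ih]
    rw [show 2 * (2 * M) = 4 * M by ring, show 2 * (2 * M + 1) = 4 * M + 1 + 1 by ring]
    ring

/-- The conjugate-pair split-radix decomposition of the discrete Fourier transform. -/
lemma dft_split {M : ℕ} (hM : M ≠ 0) (x : ℕ → ℝ) (k : ℤ) :
    dft (4 * M) x k = dft (2 * M) (fun n => x (2 * n)) k +
      dftRoot (4 * M) ^ k * dft M (fun n => x (4 * n + 1)) k +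
      dftRoot (4 * M) ^ (-k) * dft M (fun n => x ((4 * n + (4 * M - 1)) % (4 * M))) k := by
  have h0 := dftRoot_ne_zero (4 * M)
  have hper : ∀ a : ℤ, dftRoot (4 * M) ^ ((a + 4 * M) * k) = dftRoot (4 * M) ^ (a * k) := by
    intro a
    have := dftRoot_zpow_self (N := 4 * M) (by omega)
    push_cast at this
    rw [add_mul, zpow_add₀ h0, zpow_mul _ (4 * M : ℤ), this, one_zpow, mul_one]
  rw [dft, sum_range_four_mul, dft, dft, dft, Finset.mul_sum, Finset.mul_sum]
  congr 1
  · congr 1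
    · refine Finset.sum_congr rfl fun n _ => ?_
      rw [← dftRoot_zpow_mul (a := 2) (N := 2 * M) (by norm_num), show 2 * (2 * M) = 4 * M by ring]
      congr 2; push_cast; ring
    · refine Finset.sum_congr rfl fun n _ => ?_
      rw [← dftRoot_zpow_mul (a := 4) (N := M) (by norm_num), mul_left_comm, ← zpow_add₀ h0]
      congr 2; push_cast; ring
  -- The twiddle factor merges with the kernel to give the phase of sample 4n - 1.
  · have hterm : ∀ n : ℕ, dftRoot (4 * M) ^ (-k) *
        ((x ((4 * n + (4 * M - 1)) % (4 * M)) : ℂ) * dftRoot M ^ (n * k)) =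
        (x ((4 * n + (4 * M - 1)) % (4 * M)) : ℂ) * dftRoot (4 * M) ^ ((4 * n - 1 : ℤ) * k) := by
      intro n
      rw [← dftRoot_zpow_mul (a := 4) (N := M) (by norm_num), mul_left_comm, ← zpow_add₀ h0]
      congr 2; push_cast; ring
    simp only [hterm]
    obtain ⟨L, rfl⟩ := Nat.exists_eq_succ_of_ne_zero hM
    rw [Nat.succ_eq_add_one] at *
    -- The term n = 0 of the 4n - 1 sum wraps around to sample 4M - 1, the last one in the class 3
    -- mod 4. So one sum loses its last term and the other its first, and the rest match after a
    -- shift.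
    rw [Finset.sum_range_succ, Finset.sum_range_succ']
    congr 1
    · refine Finset.sum_congr rfl fun n hn => ?_
      have hn := Finset.mem_range.1 hn
      have : (4 * (n + 1) + (4 * (L + 1) - 1)) % (4 * (L + 1)) = 4 * n + 3 := by
        rw [show 4 * (n + 1) + (4 * (L + 1) - 1) = 4 * n + 3 + 4 * (L + 1) by omega,
          Nat.add_mod_right, Nat.mod_eq_of_lt (by omega)]
      rw [this]
      congr 2; push_cast; ring
    · rw [Nat.mod_eq_of_lt (by omega), show 4 * 0 + (4 * (L + 1) - 1) = 4 * L + 3 by omega,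
        ← hper (4 * (0 : ℕ) - 1)]
      congr 2; push_cast; ring

/-- Frequencies shifted by half the size, in terms of the three subtransforms. -/
lemma dft_split_add_half {M : ℕ} (hM : M ≠ 0) (x : ℕ → ℝ) (k : ℤ) :
    dft (4 * M) x (k + 2 * M) = dft (2 * M) (fun n => x (2 * n)) k -
      (dftRoot (4 * M) ^ k * dft M (fun n => x (4 * n + 1)) k +
      dftRoot (4 * M) ^ (-k) * dft M (fun n => x ((4 * n + (4 * M - 1)) % (4 * M))) k) := by
  have h0 := dftRoot_ne_zero (4 * M)
  have h2 : ∀ y : ℕ → ℝ, dft (2 * M) y (k + 2 * M) = dft (2 * M) y k := fun y => by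
    simpa using dft_add_size (N := 2 * M) (by omega) y k
  have h1 : ∀ y : ℕ → ℝ, dft M y (k + 2 * M) = dft M y k := fun y => by
    rw [two_mul, ← add_assoc, dft_add_size hM, dft_add_size hM]
  have hw : dftRoot (4 * M) ^ (2 * M : ℤ) = -1 := by
    rw [mul_comm (2 : ℤ), zpow_mul, dftRoot_quarter hM]
    simp [zpow_ofNat]
  rw [dft_split hM, h2, h1, h1, neg_add, zpow_add₀ h0, zpow_add₀ h0, zpow_neg _ (2 * M : ℤ), hw]
  norm_num
  ring

/-- Frequencies shifted by a quarter of the size, in terms of the three subtransforms. -/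
lemma dft_split_add_quarter {M : ℕ} (hM : M ≠ 0) (x : ℕ → ℝ) (k : ℤ) :
    dft (4 * M) x (k + M) = dft (2 * M) (fun n => x (2 * n)) (k + M) - Complex.I *
      (dftRoot (4 * M) ^ k * dft M (fun n => x (4 * n + 1)) k -
      dftRoot (4 * M) ^ (-k) * dft M (fun n => x ((4 * n + (4 * M - 1)) % (4 * M))) k) := by
  have h0 := dftRoot_ne_zero (4 * M)
  rw [dft_split hM, dft_add_size hM, dft_add_size hM, neg_add, zpow_add₀ h0, zpow_add₀ h0,
    zpow_neg _ (M : ℤ), dftRoot_quarter hM, inv_neg, Complex.inv_I]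
  ring

/-- For real input this is the conjugate of the output at k + 2M, since 2M - k = -(k + 2M) modulo
4M. -/
lemma dft_reflect_half {M : ℕ} (hM : M ≠ 0) (x : ℕ → ℝ) (k : ℤ) :
    dft (4 * M) x (2 * M - k) = star (dft (2 * M) (fun n => x (2 * n)) k) -
      star (dftRoot (4 * M) ^ k * dft M (fun n => x (4 * n + 1)) k +
      dftRoot (4 * M) ^ (-k) * dft M (fun n => x ((4 * n + (4 * M - 1)) % (4 * M))) k) := by
  rw [← star_sub, ← dft_split_add_half hM, star_dft,
    ← dft_add_size (by omega) x (-(k + 2 * M))]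
  congr 1; push_cast; ring

/-- The even-sample transform has period 2M, so its value at k + M is the conjugate of the one at M
- k. Only its nonredundant half is needed. -/
lemma dft_shift_quarter {M : ℕ} (hM : M ≠ 0) (x : ℕ → ℝ) (k : ℤ) :
    dft (4 * M) x (k + M) = star (dft (2 * M) (fun n => x (2 * n)) (M - k)) - Complex.I *
      (dftRoot (4 * M) ^ k * dft M (fun n => x (4 * n + 1)) k -
      dftRoot (4 * M) ^ (-k) * dft M (fun n => x ((4 * n + (4 * M - 1)) % (4 * M))) k) := by
  rw [dft_split_add_quarter hM, star_dft, ← dft_add_size (N := 2 * M) (by omega) _ (-(M - k))]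
  congr 2; push_cast; ring

/-- The quarter shift at frequency -k; negating k conjugates both twiddled subtransforms. -/
lemma dft_reflect_quarter {M : ℕ} (hM : M ≠ 0) (x : ℕ → ℝ) (k : ℤ) :
    dft (4 * M) x (M - k) = dft (2 * M) (fun n => x (2 * n)) (M - k) - Complex.I *
      star (dftRoot (4 * M) ^ k * dft M (fun n => x (4 * n + 1)) k -
      dftRoot (4 * M) ^ (-k) * dft M (fun n => x ((4 * n + (4 * M - 1)) % (4 * M))) k) := by
  have := dft_split_add_quarter hM x (-k)
  rw [neg_add_eq_sub] at this
  rw [this, star_sub, star_mul', star_mul', star_dft, star_dft, star_dftRoot_zpow,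
    star_dftRoot_zpow]

lemma star_dft_of_two_mul_eq {N : ℕ} (hN : N ≠ 0) (x : ℕ → ℝ) {k : ℤ} (hk : k = 0 ∨ 2 * k = N) :
    star (dft N x k) = dft N x k := by
  rw [star_dft]
  rcases hk with rfl | hk
  · simp
  · rw [← dft_add_size hN]; congr 1; omega

/-! ### Butterflies on register pairs -/

/-- The complex number held in a register pair. -/
def Cx.toC (z : Cx ℝ) : ℂ := ⟨z.re, z.im⟩

@[simp] lemma Cx.toC_re (z : Cx ℝ) : z.toC.re = z.re := rfl
@[simp] lemma Cx.toC_im (z : Cx ℝ) : z.toC.im = z.im := rfl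

/-- The factor `ℓ` of a scale index. -/
def Scale.val : Scale → ℕ
  | .one => 1
  | .two => 2
  | .four => 4

/-- The factor s_{M,k} cancels: a quarter-size output scaled by s_{M,k} becomes a twiddled one
scaled by s_{4M,k}. -/
lemma t_mul_div {M k : ℕ} (o : ℂ) :
    t (4 * M) k * (o / (s M k : ℂ)) = dftRoot (4 * M) ^ (k : ℤ) * o / (s (4 * M) k : ℂ) := by
  have h1 : (s M k : ℂ) ≠ 0 := by exact_mod_cast s_ne_zero M k
  rw [t, Nat.mul_div_cancel_left _ (by norm_num), zpow_natCast]
  push_cast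
  field_simp

lemma star_t_mul_div {M k : ℕ} (o : ℂ) :
    star (t (4 * M) k) * (o / (s M k : ℂ)) =
      dftRoot (4 * M) ^ (-k : ℤ) * o / (s (4 * M) k : ℂ) := by
  have h1 : (s M k : ℂ) ≠ 0 := by exact_mod_cast s_ne_zero M k
  rw [t, Nat.mul_div_cancel_left _ (by norm_num), ← zpow_natCast, star_mul', star_dftRoot_zpow]
  simp only [Complex.star_def, Complex.conj_ofReal]
  push_cast
  field_simp

lemma toC_cscale (c : ℝ) (z : Cx ℝ) : (cscale c z).eval.toC = c * z.toC := by
  apply Complex.ext <;> simp [cscale]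

lemma toC_bodyGeneric_one {N k : ℕ} (u v z z' : Cx ℝ) (h : (t N k).re = 1) :
    let a := t N k * z.toC
    let b := star (t N k) * z'.toC
    let r := (bodyGeneric N k .one u v z z').eval
    r.1.toC = u.toC + (a + b) ∧
    r.2.1.toC = v.toC - Complex.I * star (a - b) ∧
    r.2.2.1.toC = star v.toC - Complex.I * (a - b) ∧
    r.2.2.2.toC = star u.toC - star (a + b) := by
  refine ⟨?_, ?_, ?_, ?_⟩ <;> apply Complex.ext <;>
    simp [bodyGeneric, twiddle, cmulUnitRe, h] <;> ring

lemma toC_bodyGeneric_two {N k : ℕ} (u v z z' : Cx ℝ) (h : (t N k).re = 1) :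
    let a := t N k * z.toC
    let b := star (t N k) * z'.toC
    let c : ℂ := (s N k / s (2 * N) k : ℝ)
    let d : ℂ := (s N k / s (2 * N) (k + N / 4) : ℝ)
    let r := (bodyGeneric N k .two u v z z').eval
    r.1.toC = u.toC + c * (a + b) ∧
    r.2.1.toC = v.toC - Complex.I * (d * star (a - b)) ∧
    r.2.2.1.toC = star v.toC - Complex.I * (d * (a - b)) ∧
    r.2.2.2.toC = star u.toC - c * star (a + b) := by
  refine ⟨?_, ?_, ?_, ?_⟩ <;> apply Complex.ext <;>
    simp [-Complex.ofReal_div, -mul_eq_mul_left_iff, bodyGeneric, twiddle, cmulUnitRe, cscale, h] <;> ring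

lemma toC_bodyGeneric_four {N k : ℕ} (u v z z' : Cx ℝ) (h : (t N k).re = 1) :
    let a := t N k * z.toC
    let b := star (t N k) * z'.toC
    let r := (bodyGeneric N k .four u v z z').eval
    r.1.toC = (s N k / s (4 * N) k : ℝ) * (u.toC + (a + b)) ∧
    r.2.1.toC = (s N k / s (4 * N) (N / 4 - k) : ℝ) * (v.toC - Complex.I * star (a - b)) ∧
    r.2.2.1.toC = (s N k / s (4 * N) (k + N / 4) : ℝ) * (star v.toC - Complex.I * (a - b)) ∧
    r.2.2.2.toC = (s N k / s (4 * N) (N / 2 - k) : ℝ) * (star u.toC - star (a + b)) := by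
  obtain ⟨g1, g2, g3, g4⟩ := toC_bodyGeneric_one u v z z' h
  exact ⟨(toC_cscale _ _).trans (congrArg _ g1), (toC_cscale _ _).trans (congrArg _ g2),
    (toC_cscale _ _).trans (congrArg _ g3), (toC_cscale _ _).trans (congrArg _ g4)⟩

lemma s_quarter_sub {j k : ℕ} (M : ℕ) (hM : 4 * M = 2 ^ j) (hk : k ≤ M) :
    s (4 * M) (M - k) = s (4 * M) k := by
  rw [hM]
  exact s_reflect j (Or.inr ⟨1, by omega⟩)

/-- Everything is a matter of scale factors. For ℓ = 1 the four outputs and the half-size data share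
the single factor s_{4M,k}. For ℓ = 2 the half-size data already carry the target factors of size
8M, which pair up (k with 2M - k, M - k with k + M), so only the quarter-size terms are rescaled, by
two constants. For ℓ = 4 each output is rescaled separately. -/
lemma bodyGeneric_spec {m k M : ℕ} (hM : M = 2 ^ m) (hk : 2 * k ≤ M) (hM1 : 1 < M)
    (ℓ : Scale) (x : ℕ → ℝ) {u v z z' : Cx ℝ}
    (hu : u.toC = dft (2 * M) (fun n => x (2 * n)) k / s (ℓ.sub.val * (2 * M)) k)
    (hv : v.toC = dft (2 * M) (fun n => x (2 * n)) (M - k : ℕ) /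
      s (ℓ.sub.val * (2 * M)) (M - k))
    (hz : z.toC = dft M (fun n => x (4 * n + 1)) k / s M k)
    (hz' : z'.toC = dft M (fun n => x ((4 * n + (4 * M - 1)) % (4 * M))) k / s M k) :
    let r := (bodyGeneric (4 * M) k ℓ u v z z').eval
    r.1.toC = dft (4 * M) x k / s (ℓ.val * (4 * M)) k ∧
    r.2.1.toC = dft (4 * M) x (M - k : ℕ) / s (ℓ.val * (4 * M)) (M - k) ∧
    r.2.2.1.toC = dft (4 * M) x (k + M : ℕ) / s (ℓ.val * (4 * M)) (k + M) ∧
    r.2.2.2.toC = dft (4 * M) x (2 * M - k : ℕ) / s (ℓ.val * (4 * M)) (2 * M - k) := by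
  have hM0 : M ≠ 0 := by omega
  have ht : (t (4 * M) k).re = 1 := t_re (by omega) (by omega)
  have ha := t_mul_div (M := M) (k := k) (dft M (fun n => x (4 * n + 1)) k)
  have hb := star_t_mul_div (M := M) (k := k)
    (dft M (fun n => x ((4 * n + (4 * M - 1)) % (4 * M))) k)
  rw [← hz] at ha
  rw [← hz'] at hb
  have h1 := dft_split hM0 x k
  have h2 := dft_reflect_quarter hM0 x k
  have h3 := dft_shift_quarter hM0 x k
  have h4 := dft_reflect_half hM0 x k
  rw [add_assoc] at h1
  have c2 : ((M - k : ℕ) : ℤ) = M - k := by push_cast [show k ≤ M by omega]; ring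
  have c3 : ((k + M : ℕ) : ℤ) = k + M := by push_cast; ring
  have c4 : ((2 * M - k : ℕ) : ℤ) = 2 * M - k := by push_cast [show k ≤ 2 * M by omega]; ring
  have q4 : 4 * M / 4 = M := by omega
  have q2 : 4 * M / 2 = 2 * M := by omega
  have p4 : 4 * M = 2 ^ (m + 2) := by rw [hM]; ring
  have p8 : 4 * (2 * M) = 2 ^ (m + 3) := by rw [hM]; ring
  have s1 : s (4 * M) (M - k) = s (4 * M) k := s_quarter_sub M p4 (by omega)
  have s2 : s (4 * M) (k + M) = s (4 * M) k := by
    simpa [q4] using s_add_quarter (4 * M) k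
  have s3 : s (4 * M) (2 * M - k) = s (4 * M) k := by
    rw [p4]; exact s_reflect _ (Or.inr ⟨2, by rw [← p4]; omega⟩)
  have s4 : s (4 * (2 * M)) (2 * M - k) = s (4 * (2 * M)) k := s_quarter_sub _ p8 (by omega)
  have s5 : s (4 * (2 * M)) (k + M) = s (4 * (2 * M)) (M - k) := by
    rw [p8]; exact s_reflect _ (Or.inr ⟨1, by rw [← p8]; omega⟩)
  have r1 : 1 * (4 * M) = 4 * M := by ring
  have r2 : 2 * (4 * M) = 4 * (2 * M) := by ring
  have r3 : 2 * (2 * M) = 4 * M := by ring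
  have n1 : (s (4 * M) k : ℂ) ≠ 0 := by exact_mod_cast s_ne_zero _ _
  have n2 : ∀ j, (s (4 * (2 * M)) j : ℂ) ≠ 0 := fun j => by exact_mod_cast s_ne_zero _ _
  have n3 : ∀ j, (s (4 * (4 * M)) j : ℂ) ≠ 0 := fun j => by exact_mod_cast s_ne_zero _ _
  rw [c2] at hv
  rw [c2, c3, c4, h1, h2, h3, h4]
  -- From here only field identities in the subtransform values and scale factors remain.
  generalize dftRoot (4 * M) ^ (k : ℤ) * dft M (fun n => x (4 * n + 1)) k = a at *
  generalize dftRoot (4 * M) ^ (-k : ℤ) *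
    dft M (fun n => x ((4 * n + (4 * M - 1)) % (4 * M))) k = b at *
  generalize dft (2 * M) (fun n => x (2 * n)) k = e at *
  generalize dft (2 * M) (fun n => x (2 * n)) (M - k) = e' at *
  rw [Complex.star_def] at hb
  cases ℓ with
  | one =>
    simp only [Scale.val, Scale.sub, r1, r3, s1, s2, s3] at hu hv ⊢
    obtain ⟨g1, g2, g3, g4⟩ := toC_bodyGeneric_one u v z z' ht
    simp only [ha, hb, hu, hv, star_add, star_sub, star_div₀, Complex.star_def,
      Complex.conj_ofReal] at g1 g2 g3 g4 ⊢
    rw [g1, g2, g3, g4]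
    refine ⟨?_, ?_, ?_, ?_⟩ <;> ring
  | two =>
    simp only [Scale.val, Scale.sub, r2, s4, s5] at hu hv ⊢
    obtain ⟨g1, g2, g3, g4⟩ := toC_bodyGeneric_two u v z z' ht
    simp only [ha, hb, hu, hv, star_add, star_sub, star_div₀, Complex.star_def,
      Complex.conj_ofReal, Complex.ofReal_div, q4, r2, s5] at g1 g2 g3 g4 ⊢
    rw [g1, g2, g3, g4]
    have := n2 k
    have := n2 (M - k)
    refine ⟨?_, ?_, ?_, ?_⟩ <;> field_simp
  | four =>
    simp only [Scale.val, Scale.sub, r3, s1] at hu hv ⊢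
    obtain ⟨g1, g2, g3, g4⟩ := toC_bodyGeneric_four u v z z' ht
    simp only [ha, hb, hu, hv, star_add, star_sub, star_div₀, Complex.star_def,
      Complex.conj_ofReal, Complex.ofReal_div, q4, q2] at g1 g2 g3 g4 ⊢
    rw [g1, g2, g3, g4]
    have := n3 k
    have := n3 (M - k)
    have := n3 (k + M)
    have := n3 (2 * M - k)
    refine ⟨?_, ?_, ?_, ?_⟩ <;> field_simp

/-- All four inputs are real and s_{·,0} = 1, so by periodicity most scale factors are 1. For ℓ = 2
the value `v` already carries s_{8M,M}, and only the imaginary part z' - z is multiplied. -/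
lemma bodyZero_spec {m M : ℕ} (hM : M = 2 ^ m) (ℓ : Scale) (x : ℕ → ℝ) {u v z z' : ℝ}
    (hu : (u : ℂ) = dft (2 * M) (fun n => x (2 * n)) 0)
    (hv : (v : ℂ) = dft (2 * M) (fun n => x (2 * n)) M / s (ℓ.sub.val * (2 * M)) M)
    (hz : (z : ℂ) = dft M (fun n => x (4 * n + 1)) 0)
    (hz' : (z' : ℂ) = dft M (fun n => x ((4 * n + (4 * M - 1)) % (4 * M))) 0) :
    let r := (bodyZero (4 * M) ℓ u v z z').eval
    r.1.toC = dft (4 * M) x 0 ∧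
    r.2.1.toC = dft (4 * M) x M / s (ℓ.val * (4 * M)) M ∧
    r.2.2.toC = dft (4 * M) x (2 * M) / s (ℓ.val * (4 * M)) (2 * M) := by
  have hM0 : M ≠ 0 := by rw [hM]; positivity
  have h1 := dft_split hM0 x 0
  have h2 := dft_split_add_quarter hM0 x 0
  have h3 := dft_split_add_half hM0 x 0
  simp only [zero_add, neg_zero, zpow_zero, one_mul, ← hu, ← hz, ← hz'] at h1 h2 h3
  have q4 : 4 * M / 4 = M := by omega
  have q2 : 4 * M / 2 = 2 * M := by omega
  have r1 : 1 * (4 * M) = 4 * M := by ring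
  have r2 : 2 * (2 * M) = 4 * M := by ring
  have s1 : s (4 * M) M = 1 := by
    have := s_add_quarter (4 * M) 0
    rwa [q4, zero_add, s_zero] at this
  have s2 : s (4 * M) (2 * M) = 1 := by
    have := s_add_quarter (4 * M) M
    rwa [q4, s1, ← two_mul] at this
  have s3 : s (2 * (4 * M)) (2 * M) = 1 := by
    have := s_add_quarter (2 * (4 * M)) 0
    rwa [show 2 * (4 * M) / 4 = 2 * M by omega, zero_add, s_zero] at this
  rw [h1, h2, h3]
  cases ℓ with
  | one =>
    simp only [Scale.val, Scale.sub, r1, r2, s1, s2, Complex.ofReal_one, div_one] at hv ⊢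
    rw [← hv]
    refine ⟨?_, ?_, ?_⟩ <;> apply Complex.ext <;> simp [bodyZero] <;> ring
  | two =>
    simp only [Scale.val, Scale.sub, s3, Complex.ofReal_one, div_one] at hv ⊢
    rw [show 4 * (2 * M) = 2 * (4 * M) by ring] at hv
    rw [sub_div, ← hv]
    generalize hc : s (2 * (4 * M)) M = c
    refine ⟨?_, ?_, ?_⟩ <;> apply Complex.ext <;>
      simp [bodyZero, q4, hc, -mul_eq_mul_left_iff, Complex.div_re, Complex.div_im,
        Complex.normSq_apply]
    · ring
    · have hc0 : c ≠ 0 := hc ▸ s_ne_zero _ _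
      field_simp
      ring
  | four =>
    simp only [Scale.val, Scale.sub, r2, s1, Complex.ofReal_one, div_one] at hv ⊢
    rw [← hv]
    have e : ∀ (a : ℝ) (w : ℂ), ((1 / a : ℝ) : ℂ) * w = w / a := fun a w => by
      push_cast; ring
    refine ⟨?_, ?_, ?_⟩
    · apply Complex.ext <;> simp [bodyZero]
      ring
    · rw [← e]
      refine (toC_cscale (1 / s (4 * (4 * M)) (4 * M / 4)) ⟨v, z' - z⟩).trans ?_
      rw [q4, show (Cx.mk v (z' - z)).toC = v - Complex.I * (z - z') from
        Complex.ext (by simp) (by simp)]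
    · rw [← e, ← q2]
      have : ∀ a b : ℝ, (Cx.mk (a * b) 0).toC = (a : ℂ) * b := fun a b => by
        apply Complex.ext <;> simp
      refine (this _ _).trans ?_
      push_cast
      ring

/-- The real part is 1 by `t_re`, and at angle π/4 sine equals cosine. -/
lemma t_eighth {H : ℕ} (hH : 0 < H) : t (8 * H) H = 1 - Complex.I := by
  have hre := t_re (N := 8 * H) (k := H) (by omega) (by omega)
  have h4 : 2 * Real.pi * H / (8 * H : ℕ) = Real.pi / 4 := by
    have : (H : ℝ) ≠ 0 := by positivity
    push_cast; field_simp; ring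
  have h1 := dftRoot_zpow_re (8 * H) H
  have h2 := dftRoot_zpow_im (8 * H) H
  rw [zpow_natCast, Int.cast_natCast, h4] at h1 h2
  rw [Real.cos_pi_div_four] at h1
  rw [Real.sin_pi_div_four] at h2
  apply Complex.ext
  · simpa using hre
  · rw [t, Complex.re_mul_ofReal, h1] at hre
    rw [t, Complex.im_mul_ofReal, h2, neg_mul, hre]
    simp

/-- Here k = N/4 - k, so the four outputs collapse to two. With z, z' real, (1 - i)z + (1 + i)z' =
(z + z') + i(z' - z) costs no multiplication. -/
lemma bodyEighth_spec {m H : ℕ} (hH : H = 2 ^ m) (ℓ : Scale) (x : ℕ → ℝ) {u : Cx ℝ} {z z' : ℝ}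
    (hu : u.toC = dft (4 * H) (fun n => x (2 * n)) H / s (ℓ.sub.val * (4 * H)) H)
    (hz : (z : ℂ) = dft (2 * H) (fun n => x (4 * n + 1)) H / s (2 * H) H)
    (hz' : (z' : ℂ) = dft (2 * H) (fun n => x ((4 * n + (8 * H - 1)) % (8 * H))) H /
      s (2 * H) H) :
    let r := (bodyEighth (8 * H) ℓ u z z').eval
    r.1.toC = dft (8 * H) x H / s (ℓ.val * (8 * H)) H ∧
    r.2.toC = dft (8 * H) x (3 * H : ℕ) / s (ℓ.val * (8 * H)) (3 * H) := by
  have hH0 : 0 < H := by rw [hH]; positivity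
  have h1 := dft_split (M := 2 * H) (by omega) x H
  have h4 := dft_reflect_half (M := 2 * H) (by omega) x H
  have ha := t_mul_div (M := 2 * H) (k := H) (dft (2 * H) (fun n => x (4 * n + 1)) H)
  have hb := star_t_mul_div (M := 2 * H) (k := H)
    (dft (2 * H) (fun n => x ((4 * n + (8 * H - 1)) % (8 * H))) H)
  rw [show 4 * (2 * H) = 8 * H by ring, show 2 * (2 * H) = 4 * H by ring] at h1 h4
  rw [show 4 * (2 * H) = 8 * H by ring] at ha hb
  rw [← hz, t_eighth hH0] at ha
  rw [← hz', t_eighth hH0] at hb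
  rw [show (2 * ((2 * H : ℕ) : ℤ) - H) = (3 * H : ℕ) by push_cast; ring] at h4
  rw [add_assoc] at h1
  have q8 : 8 * H / 8 = H := by omega
  have q38 : 3 * (8 * H) / 8 = 3 * H := by omega
  have p8 : 8 * H = 2 ^ (m + 3) := by rw [hH]; ring
  have p16 : 2 * (8 * H) = 2 ^ (m + 4) := by rw [hH]; ring
  have s1 : s (8 * H) (3 * H) = s (8 * H) H := by
    rw [p8]; exact s_reflect _ (Or.inr ⟨2, by rw [← p8]; omega⟩)
  have s2 : s (2 * (8 * H)) (3 * H) = s (2 * (8 * H)) H := by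
    rw [p16]; exact s_reflect _ (Or.inr ⟨1, by rw [← p16]; omega⟩)
  have n1 : (s (8 * H) H : ℂ) ≠ 0 := by exact_mod_cast s_ne_zero _ _
  have n2 : (s (2 * (8 * H)) H : ℂ) ≠ 0 := by exact_mod_cast s_ne_zero _ _
  have n3 : ∀ j, (s (4 * (8 * H)) j : ℂ) ≠ 0 := fun j => by exact_mod_cast s_ne_zero _ _
  rw [h1, h4]
  generalize dftRoot (8 * H) ^ (H : ℤ) * dft (2 * H) (fun n => x (4 * n + 1)) H = a at *
  generalize dftRoot (8 * H) ^ (-H : ℤ) *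
    dft (2 * H) (fun n => x ((4 * n + (8 * H - 1)) % (8 * H))) H = b at *
  generalize dft (4 * H) (fun n => x (2 * n)) H = e at *
  have hab : (Cx.mk (z + z') (z' - z)).toC = (a + b) / s (8 * H) H := by
    rw [add_div, ← ha, ← hb]
    apply Complex.ext <;> simp
    ring
  have one : ∀ p : Cx ℝ, (Cx.mk (u.re + p.re) (u.im + p.im)).toC = u.toC + p.toC ∧
      (Cx.mk (u.re - p.re) (p.im - u.im)).toC = star u.toC - star p.toC := fun p => by
    constructor <;> apply Complex.ext <;> simp
    ring
  cases ℓ with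
  | one =>
    simp only [Scale.val, Scale.sub, one_mul, show 2 * (4 * H) = 8 * H by ring, s1] at hu ⊢
    refine ⟨(one ⟨z + z', z' - z⟩).1.trans ?_, (one ⟨z + z', z' - z⟩).2.trans ?_⟩
    all_goals simp only [hab, hu, star_add, star_div₀, Complex.star_def, Complex.conj_ofReal]
    all_goals ring
  | two =>
    simp only [Scale.val, Scale.sub, show 4 * (4 * H) = 2 * (8 * H) by ring, s2] at hu ⊢
    have hp := toC_cscale (s (8 * H) (8 * H / 8) / s (2 * (8 * H)) (8 * H / 8))
      ⟨z + z', z' - z⟩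
    refine ⟨(one _).1.trans ((congrArg _ hp).trans ?_), (one _).2.trans
      ((congrArg (fun w => _ - star w) hp).trans ?_)⟩
    all_goals simp only [q8, hab, hu, star_add, star_div₀, star_mul', Complex.star_def,
      Complex.conj_ofReal, Complex.ofReal_div]
    all_goals field_simp
  | four =>
    simp only [Scale.val, Scale.sub, show 2 * (4 * H) = 8 * H by ring] at hu ⊢
    refine ⟨(toC_cscale _ _).trans ((congrArg _ (one ⟨z + z', z' - z⟩).1).trans ?_),
      (toC_cscale _ _).trans ((congrArg _ (one ⟨z + z', z' - z⟩).2).trans ?_)⟩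
    all_goals simp only [q8, q38, hab, hu, star_add, star_div₀, Complex.star_def,
      Complex.conj_ofReal, Complex.ofReal_div]
    all_goals have := n3 H
    all_goals have := n3 (3 * H)
    all_goals field_simp

/-! ### Correctness of the scaled FFT -/

lemma dft_zero_im {N : ℕ} {x : ℕ → ℝ} (hN : N ≠ 0) {k : ℕ} (hk : k = 0 ∨ 2 * k = N) :
    (dft N x k).im = 0 := by
  have := star_dft_of_two_mul_eq hN x (k := k) (by omega)
  exact Complex.conj_eq_iff_im.1 this

/-- Frequencies 0 and N/2 are their own negatives modulo N, so the value is real and the algorithm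
may read the real register alone. -/
lemma Cx.ofReal_re_of_eq_dft {N L k : ℕ} {x : ℕ → ℝ} {z : Cx ℝ} (hN : N ≠ 0)
    (hk : k = 0 ∨ 2 * k = N) (hz : z.toC = dft N x k / s L k) :
    (z.re : ℂ) = dft N x k / s L k := by
  rw [← hz]
  apply Complex.ext
  · simp
  · rw [hz, Complex.div_ofReal_im, dft_zero_im hN hk]; simp

/-- The rescaled real-input FFT computes the discrete Fourier transform up to scaling. -/
theorem toC_rnsplitfft (m : ℕ) (ℓ : Scale) (x : ℕ → ℝ) {k : ℕ} (hk : 2 * k ≤ 2 ^ m) :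
    ((rnsplitfft m ℓ x).eval k).toC = dft (2 ^ m) x k / s (ℓ.val * 2 ^ m) k := by
  induction m using Nat.twoStepInduction generalizing ℓ x k with
  | zero =>
    obtain rfl : k = 0 := by omega
    rw [s_zero]
    apply Complex.ext <;> simp [rnsplitfft, dft]
  | one =>
    have hw : dftRoot 2 = -1 := by
      have h := dftRoot_zpow 2 1
      rw [zpow_one] at h
      rw [h, show -(2 * Real.pi * (1 : ℤ) / (2 : ℕ)) = -Real.pi by push_cast; ring]
      push_cast
      rw [neg_mul, Complex.exp_neg, Complex.exp_pi_mul_I]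
      norm_num
    obtain rfl | rfl : k = 0 ∨ k = 1 := by omega
    · rw [s_zero]
      apply Complex.ext <;> cases ℓ <;> simp [rnsplitfft, dft, Finset.sum_range_succ]
    · have hd : dft (2 ^ 1) x (1 : ℕ) = ((x 0 - x 1 : ℝ) : ℂ) := by
        simp [dft, Finset.sum_range_succ, hw, sub_eq_add_neg]
      rw [hd]
      -- The scale factor has size 2, 4 or 8, and is 1 by definition in the first two cases.
      cases ℓ with
      | one =>
        rw [Scale.val, s_of_le (by norm_num)]
        apply Complex.ext <;> simp [rnsplitfft]
      | two =>
        rw [Scale.val, s_of_le (by norm_num)]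
        apply Complex.ext <;> simp [rnsplitfft]
      | four =>
        rw [Scale.val, ← Complex.ofReal_div]
        apply Complex.ext
        · rw [Complex.ofReal_re]
          simp [rnsplitfft, div_eq_inv_mul]
        · rw [Complex.ofReal_im]
          simp [rnsplitfft]
  | more m ih1 ih2 =>
    have e4 : 2 ^ (m + 2) = 4 * 2 ^ m := by ring
    have e2 : 2 ^ (m + 1) = 2 * 2 ^ m := by ring
    have U : ∀ j, 2 * j ≤ 2 * 2 ^ m → _ := fun j hj =>
      ih2 ℓ.sub (fun n => x (2 * n)) (k := j) (by omega)
    have Z : ∀ j, 2 * j ≤ 2 ^ m → _ := fun j hj =>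
      ih1 .one (fun n => x (4 * n + 1)) (k := j) hj
    have Z' : ∀ j, 2 * j ≤ 2 ^ m → _ := fun j hj =>
      ih1 .one (fun n => x ((4 * n + (4 * 2 ^ m - 1)) % (4 * 2 ^ m))) (k := j) hj
    rw [e4] at hk ⊢
    simp only [rnsplitfft, eval_bind, e4]
    simp only [show Scale.val .one = 1 from rfl, one_mul] at Z Z'
    rw [e2] at U
    generalize (rnsplitfft (m + 1) ℓ.sub (fun n => x (2 * n))).eval = u at *
    generalize (rnsplitfft m .one (fun n => x (4 * n + 1))).eval = z at *
    generalize (rnsplitfft m .one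
      (fun n => x ((4 * n + (4 * 2 ^ m - 1)) % (4 * 2 ^ m)))).eval = z' at *
    clear ih1 ih2 e2 e4
    generalize hM' : 2 ^ m = M at *
    have hM := hM'.symm
    have hM0 : M ≠ 0 := by rw [hM]; positivity
    have q4 : 4 * M / 4 = M := by omega
    have q2 : 4 * M / 2 = 2 * M := by omega
    have A := bodyZero_spec hM ℓ x (u := (u 0).re) (v := (u M).re) (z := (z 0).re)
      (z' := (z' 0).re)
      (by rw [Cx.ofReal_re_of_eq_dft (by omega) (Or.inl rfl) (U 0 (by omega)), s_zero]; simp)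
      (Cx.ofReal_re_of_eq_dft (by omega) (Or.inr rfl) (U M (by omega)))
      (by rw [Cx.ofReal_re_of_eq_dft (by omega) (Or.inl rfl) (Z 0 (by omega)), s_zero]; simp)
      (by rw [Cx.ofReal_re_of_eq_dft (by omega) (Or.inl rfl) (Z' 0 (by omega)), s_zero]; simp)
    obtain ⟨A0, A1, A2⟩ := A
    have A0' : dft (4 * M) x 0 = dft (4 * M) x (0 : ℕ) / s (ℓ.val * (4 * M)) 0 := by
      rw [s_zero]; simp
    rw [A0'] at A0
    rw [show (2 * M : ℤ) = (2 * M : ℕ) by push_cast; rfl] at A2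
    -- For N = 4 the outputs 0, 1, 2 all come from the k = 0 butterfly.
    rcases m with _ | q
    · obtain rfl : M = 1 := by simpa using hM
      have : k = 0 ∨ k = 1 ∨ k = 2 := by omega
      rw [if_pos (by norm_num)]
      simp only [eval_bind, eval_pure, q4]
      rcases this with rfl | rfl | rfl
      · simpa using A0
      · simpa using A1
      · simpa using A2
    · obtain ⟨H, hH⟩ : ∃ H, H = 2 ^ q := ⟨_, rfl⟩
      have hMH : M = 2 * H := by rw [hM, hH]; ring
      have q8 : 4 * M / 8 = H := by omega
      have q38 : 3 * (4 * M) / 8 = 3 * H := by omega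
      have E := bodyEighth_spec hH ℓ x (u := u H) (z := (z H).re) (z' := (z' H).re)
      rw [show 8 * H = 4 * M by omega, show 4 * H = 2 * M by omega, ← hMH] at E
      obtain ⟨E0, E1⟩ := E (U H (by omega))
        (Cx.ofReal_re_of_eq_dft (by omega) (Or.inr hMH.symm) (Z H (by omega)))
        (Cx.ofReal_re_of_eq_dft (by omega) (Or.inr hMH.symm) (Z' H (by omega)))
      have B : ∀ j, 0 < j → j < H → _ := fun j _ hj =>
        bodyGeneric_spec hM (k := j) (by omega) (by omega) ℓ x (U j (by omega))
          (U (M - j) (by omega)) (Z j (by omega)) (Z' j (by omega))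
      -- The table starts at 0 but the butterflies at 1, hence the shift; its default entries are
      -- never read.
      have hB : ∀ j, 0 < j → j < H → (loop (Cx.zero, Cx.zero, Cx.zero, Cx.zero)
          (fun j => bodyGeneric (4 * M) (j + 1) ℓ (u (j + 1)) (u (M - (j + 1))) (z (j + 1))
            (z' (j + 1))) (H - 1)).eval (j - 1) =
          (bodyGeneric (4 * M) j ℓ (u j) (u (M - j)) (z j) (z' j)).eval := fun j h0 hj => by
        rw [eval_loop _ _ _ (by omega)]
        simp only [Nat.sub_add_cancel h0]
      rw [if_neg (by omega)]
      simp only [eval_bind, eval_pure, q4, q2, q8, q38]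
      -- Outside the special indices, k is output of butterfly k, M - k, k - M or 2M - k according
      -- to its range.
      split_ifs with c0 c1 c2 c3 c4 c5 c6 c7
      · subst c0; exact A0
      · rw [hB k (by omega) c1]; exact (B k (by omega) c1).1
      · obtain rfl : k = H := by omega
        exact E0
      · rw [hB (M - k) (by omega) (by omega)]
        have := (B (M - k) (by omega) (by omega)).2.1
        rwa [show M - (M - k) = k by omega] at this ⊢
      · subst c4; exact A1
      · rw [hB (k - M) (by omega) (by omega)]
        have := (B (k - M) (by omega) (by omega)).2.2.1
        rwa [show k - M + M = k by omega] at this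
      · obtain rfl : k = 3 * H := by omega
        exact E1
      · rw [hB (2 * M - k) (by omega) (by omega)]
        have := (B (2 * M - k) (by omega) (by omega)).2.2.2
        rwa [show 2 * M - (2 * M - k) = k by omega] at this
      · obtain rfl : k = 2 * M := by omega
        exact A2

/-! ### The DCT-II as a twiddled DFT -/

lemma sum_range_two_mul (F : ℕ → ℝ) (M : ℕ) :
    ∑ n ∈ Finset.range (2 * M), F n = ∑ j ∈ Finset.range M, F (2 * j) +
      ∑ j ∈ Finset.range M, F (2 * j + 1) := by
  induction M with
  | zero => simp
  | succ M ih =>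
    rw [show 2 * (M + 1) = 2 * M + 1 + 1 by ring]
    simp only [Finset.sum_range_succ, ih]
    ring

/-- The discrete cosine transform as the real part of a twiddled Fourier transform. -/
lemma re_dftRoot_mul_dft {N M : ℕ} (hN : N = 2 * M) (hM : M ≠ 0) (x : Fin N → ℝ) (k : Fin N) :
    2 * (dftRoot (4 * N) ^ (k : ℤ) * dft N (reorder x) (k : ℕ)).re = dctII x k := by
  subst hN
  have hM' : (M : ℝ) ≠ 0 := by exact_mod_cast hM
  obtain ⟨k, hk⟩ := k
  -- The combined phase is ω_{4N}^{(4n+1)k}, the cosine angle of sample 2n.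
  have hcos : ∀ n : ℕ, (dftRoot (4 * (2 * M)) ^ (k : ℤ) *
      (((reorder x n : ℝ) : ℂ) * dftRoot (2 * M) ^ ((n : ℤ) * k))).re =
      reorder x n * Real.cos (Real.pi / (2 * M : ℕ) * (2 * n + 1 / 2) * k) := fun n => by
    rw [mul_left_comm, Complex.re_ofReal_mul, ← dftRoot_zpow_mul (a := 4) (N := 2 * M) (by norm_num),
      ← zpow_add₀ (dftRoot_ne_zero _), dftRoot_zpow_re]
    congr 2
    push_cast
    field_simp
    ring
  rw [dctII, dft, Finset.mul_sum, Complex.re_sum]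
  simp only [hcos]
  congr 1
  have hX : ∑ n : Fin (2 * M), x n * Real.cos (Real.pi / (2 * M : ℕ) * ((n : ℕ) + 1 / 2) * k) =
      ∑ i ∈ Finset.range (2 * M), (if h : i < 2 * M then x ⟨i, h⟩ else 0) *
        Real.cos (Real.pi / (2 * M : ℕ) * (i + 1 / 2) * k) := by
    rw [← Fin.sum_univ_eq_sum_range (fun i : ℕ => (if h : i < 2 * M then x ⟨i, h⟩ else 0) *
      Real.cos (Real.pi / (2 * M : ℕ) * (i + 1 / 2) * k))]
    exact Finset.sum_congr rfl fun n _ => by simp only [n.2, dif_pos]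
  have hadd : ∀ F : ℕ → ℝ, ∑ n ∈ Finset.range (2 * M), F n =
      ∑ n ∈ Finset.range M, F n + ∑ n ∈ Finset.range M, F (M + n) := fun F => by
    rw [two_mul, Finset.sum_range_add]
  rw [hadd, hX, sum_range_two_mul]
  congr 1
  · refine Finset.sum_congr rfl fun n hn => ?_
    have hn := Finset.mem_range.1 hn
    rw [reorder, dif_pos (by omega), dif_pos (by omega)]
    push_cast
    rfl
  · rw [← Finset.sum_range_reflect]
    refine Finset.sum_congr rfl fun n hn => ?_
    have hn := Finset.mem_range.1 hn
    have hi : 2 * (2 * M) - 1 - 2 * (M + (M - 1 - n)) = 2 * n + 1 := by omega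
    rw [reorder, dif_neg (by omega), dif_pos (by omega), dif_pos (by omega)]
    congr 1
    · congr 2
    -- At position N - 1 - n the angle is 2πk minus the cosine angle of sample 2n + 1.
    · rw [← Real.cos_nat_mul_two_pi_sub _ k]
      have : ((M - 1 - n : ℕ) : ℝ) = M - 1 - n := by
        rw [Nat.cast_sub (by omega), Nat.cast_sub (by omega)]; simp
      congr 1
      push_cast [this]
      field_simp
      ring

/-- Replacing k by N - k conjugates the DFT value and turns ω_{4N}^k into -i times its conjugate;
the factor -i exchanges real and imaginary parts. -/
lemma dctII_reflect {N M : ℕ} (hN : N = 2 * M) (hM : M ≠ 0) (x : Fin N → ℝ) {k : ℕ} (hk : k < N)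
    (h0 : 0 < k) :
    dctII x ⟨N - k, by omega⟩ =
      -2 * (dftRoot (4 * N) ^ (k : ℤ) * dft N (reorder x) k).im := by
  subst hN
  rw [← re_dftRoot_mul_dft rfl hM]
  have h1 : dft (2 * M) (reorder x) ((2 * M - k : ℕ) : ℤ) = star (dft (2 * M) (reorder x) k) := by
    rw [star_dft, ← dft_add_size (by omega) _ (-k : ℤ)]
    congr 1
    omega
  have h2 : dftRoot (4 * (2 * M)) ^ ((2 * M - k : ℕ) : ℤ) =
      -Complex.I * star (dftRoot (4 * (2 * M)) ^ (k : ℤ)) := by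
    rw [star_dftRoot_zpow, ← dftRoot_quarter (M := 2 * M) (by omega),
      ← zpow_add₀ (dftRoot_ne_zero _)]
    congr 1
    omega
  simp only [h1, h2]
  generalize dftRoot (4 * (2 * M)) ^ (k : ℤ) = w
  simp
  ring

lemma dctII_half {N M : ℕ} (hN : N = 2 * M) (hM : M ≠ 0) (x : Fin N → ℝ) :
    dctII x ⟨M, by omega⟩ = Real.sqrt 2 * (dft N (reorder x) M).re := by
  subst hN
  have hM' : (M : ℝ) ≠ 0 := by exact_mod_cast hM
  rw [← re_dftRoot_mul_dft rfl hM]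
  have h4 : 2 * Real.pi * (M : ℤ) / (4 * (2 * M) : ℕ) = Real.pi / 4 := by
    push_cast; field_simp
  rw [Complex.mul_re, dft_zero_im (by omega) (Or.inr rfl), dftRoot_zpow_re, h4,
    Real.cos_pi_div_four]
  ring

lemma s_half {N M m : ℕ} (hN : N = 2 * M) (hM : M = 2 ^ m) : s N M = 1 := by
  subst hN
  have : 2 * M = 2 ^ (m + 1) := by rw [hM]; ring
  rw [← s_zero (2 * M), this]
  rcases m with _ | m
  · exact s_reflect _ (Or.inl (by norm_num))
  · refine s_reflect _ (Or.inr ⟨2, ?_⟩)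
    rw [← this, hM, pow_succ]
    omega

/-- Since 2 s_{4N,N/2} = √2, the scaled output N/2 is Z_{N/2} itself, with no multiplication. -/
lemma s_eighth {N M m : ℕ} (hN : N = 2 * M) (hM : M = 2 ^ m) :
    s (4 * N) M = Real.sqrt 2 / 2 := by
  subst hN
  have hM0 : 0 < M := by rw [hM]; positivity
  rw [s_eq_mul_cos (by omega) (by omega), Nat.mul_div_cancel_left _ (by norm_num), s_half rfl hM,
    one_mul, ← Real.cos_pi_div_four]
  congr 1
  push_cast
  field_simp

/-! ### Correctness of the two DCT-II algorithms -/

/-- The conjugate appears because the second register holds the negated imaginary part, ready to be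
output N - k. -/
lemma toC_cmulConj (w : ℂ) (z : Cx ℝ) : (cmulConj w z).eval.toC = star (w * z.toC) := by
  apply Complex.ext
  · simp [cmulConj]
  · simp [cmulConj]; ring

lemma toC_cmulUnitReConj {w : ℂ} (hw : w.re = 1) (z : Cx ℝ) :
    (cmulUnitReConj w z).eval.toC = star (w * z.toC) := by
  apply Complex.ext
  · simp [cmulUnitReConj, hw]
  · simp [cmulUnitReConj, hw]; ring

lemma toC_rnsplitfft_one (m : ℕ) (x : ℕ → ℝ) {k : ℕ} (hk : 2 * k ≤ 2 ^ m) :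
    ((rnsplitfft m .one x).eval k).toC = dft (2 ^ m) x k / s (2 ^ m) k := by
  simpa [Scale.val] using toC_rnsplitfft m .one x hk

/-- The new algorithm computes the DCT-II. -/
theorem eval_nsplitdctII (m : ℕ) (x : Fin (2 ^ m) → ℝ) :
    (nsplitdctII m x).eval = dctII x := by
  rcases m with _ | m
  · funext k
    obtain rfl : k = ⟨0, by norm_num⟩ := by ext; have := k.2; simp at this ⊢
    simp [nsplitdctII, rnsplitfft, dctII, reorder]
  · funext k
    have hZ : ∀ k, 2 * k ≤ 2 ^ (m + 1) → _ := fun k hk =>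
      toC_rnsplitfft_one (m + 1) (reorder x) (k := k) hk
    simp only [nsplitdctII, eval_bind, eval_pure, eval_rmul]
    generalize (rnsplitfft (m + 1) .one (reorder x)).eval = z at *
    obtain ⟨M, hM⟩ : ∃ M, M = 2 ^ m := ⟨_, rfl⟩
    have hN : 2 ^ (m + 1) = 2 * M := by rw [hM]; ring
    have hM0 : M ≠ 0 := by rw [hM]; positivity
    have q2 : 2 ^ (m + 1) / 2 = M := by omega
    have hloop : ∀ j, 0 < j → j < M → ((loop Cx.zero
        (fun j => cmulConj (2 * dftRoot (4 * 2 ^ (m + 1)) ^ (j + 1) * (s (2 ^ (m + 1)) (j + 1) : ℂ))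
          (z (j + 1))) (M - 1)).eval (j - 1)).toC =
        star (2 * (dftRoot (4 * 2 ^ (m + 1)) ^ (j : ℤ) * dft (2 ^ (m + 1)) (reorder x) j)) :=
      fun j h0 hj => by
        have hs : (s (2 ^ (m + 1)) j : ℂ) ≠ 0 := by exact_mod_cast s_ne_zero _ _
        rw [eval_loop _ _ _ (by omega), Nat.sub_add_cancel h0, toC_cmulConj, hZ j (by omega),
          zpow_natCast]
        congr 1
        field_simp
    rw [q2]
    obtain ⟨k, hk⟩ := k
    split_ifs with c0 c1 c2
    · obtain rfl : k = 0 := c0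
      rw [← re_dftRoot_mul_dft hN hM0, ← Cx.toC_re, hZ 0 (by omega), s_zero]
      simp
    · rw [← re_dftRoot_mul_dft hN hM0, ← Cx.toC_re, hloop k (by simp at c0; omega) c1]
      generalize dftRoot (4 * 2 ^ (m + 1)) ^ (k : ℤ) * _ = w
      simp
    · obtain rfl : k = M := c2
      rw [dctII_half hN hM0, ← Cx.toC_re, hZ k (by omega), s_half hN hM]
      simp
    · simp only at c0 c1 c2
      have := dctII_reflect hN hM0 x (k := 2 ^ (m + 1) - k) (by omega) (by omega)
      simp only [show 2 ^ (m + 1) - (2 ^ (m + 1) - k) = k by omega] at this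
      rw [this, ← Cx.toC_im, hloop (2 ^ (m + 1) - k) (by omega) (by omega)]
      generalize dftRoot (4 * 2 ^ (m + 1)) ^ ((2 ^ (m + 1) - k : ℕ) : ℤ) * _ = w
      simp

/-- The scaled algorithm computes the rescaled DCT-II. -/
theorem eval_scaledNsplitdctII (m : ℕ) (x : Fin (2 ^ m) → ℝ) (k : Fin (2 ^ m)) :
    (scaledNsplitdctII m x).eval k = dctII x k / (2 * s (4 * 2 ^ m) k) := by
  rcases m with _ | m
  · obtain rfl : k = ⟨0, by norm_num⟩ := by ext; have := k.2; simp at this ⊢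
    simp [scaledNsplitdctII, rnsplitfft, dctII, reorder, s_zero]
  · have hZ : ∀ k, 2 * k ≤ 2 ^ (m + 1) → _ := fun k hk =>
      toC_rnsplitfft_one (m + 1) (reorder x) (k := k) hk
    simp only [scaledNsplitdctII, eval_bind, eval_pure]
    generalize (rnsplitfft (m + 1) .one (reorder x)).eval = z at *
    obtain ⟨M, hM⟩ : ∃ M, M = 2 ^ m := ⟨_, rfl⟩
    have hN : 2 ^ (m + 1) = 2 * M := by rw [hM]; ring
    have hM0 : M ≠ 0 := by rw [hM]; positivity
    have q2 : 2 ^ (m + 1) / 2 = M := by omega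
    have hloop : ∀ j, 0 < j → j < M → ((loop Cx.zero
        (fun j => cmulUnitReConj (t (4 * 2 ^ (m + 1)) (j + 1)) (z (j + 1))) (M - 1)).eval
          (j - 1)).toC =
        star (dftRoot (4 * 2 ^ (m + 1)) ^ (j : ℤ) * dft (2 ^ (m + 1)) (reorder x) j /
          s (4 * 2 ^ (m + 1)) j) :=
      fun j h0 hj => by
        rw [eval_loop _ _ _ (by omega), Nat.sub_add_cancel h0,
          toC_cmulUnitReConj (t_re (by omega) (by omega)), hZ j (by omega), t_mul_div]
    have p4 : 4 * 2 ^ (m + 1) = 2 ^ (m + 3) := by ring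
    rw [q2]
    obtain ⟨k, hk⟩ := k
    split_ifs with c0 c1 c2
    · obtain rfl : k = 0 := c0
      rw [← re_dftRoot_mul_dft hN hM0, ← Cx.toC_re, hZ 0 (by omega), s_zero]
      simp [s_zero]
    · rw [← re_dftRoot_mul_dft hN hM0, ← Cx.toC_re, hloop k (by simp at c0; omega) c1,
        mul_div_mul_left _ _ two_ne_zero, Complex.star_def, Complex.conj_re,
        Complex.div_ofReal_re]
    · obtain rfl : k = M := c2
      rw [dctII_half hN hM0, ← Cx.toC_re, hZ k (by omega), s_half hN hM, s_eighth hN hM,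
        mul_div_cancel₀ _ two_ne_zero, mul_div_cancel_left₀ _ (by positivity)]
      simp
    · simp only at c0 c1 c2
      have := dctII_reflect hN hM0 x (k := 2 ^ (m + 1) - k) (by omega) (by omega)
      simp only [show 2 ^ (m + 1) - (2 ^ (m + 1) - k) = k by omega] at this
      -- Output k was computed in the product for N - k, hence scaled by s_{4N,N-k}; reflection
      -- turns this into the required s_{4N,k}.
      have hs : s (4 * 2 ^ (m + 1)) (2 ^ (m + 1) - k) = s (4 * 2 ^ (m + 1)) k :=
        s_quarter_sub _ p4 hk.le
      rw [this, ← Cx.toC_im, hloop (2 ^ (m + 1) - k) (by omega) (by omega), hs,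
        neg_mul, ← mul_neg, mul_div_mul_left _ _ two_ne_zero, Complex.star_def, Complex.conj_im,
        Complex.div_ofReal_im, neg_div]

/-! ### Operation counts -/

/-- The scaled algorithm saves one multiplication per output. -/
theorem mults_scaledNsplitdctII (m : ℕ) (x : Fin (2 ^ m) → ℝ) :
    (scaledNsplitdctII m x).mults + 2 ^ m = (nsplitdctII m x).mults := by
  rcases m with _ | m
  · simp [scaledNsplitdctII, nsplitdctII]
  · simp only [scaledNsplitdctII, nsplitdctII, mults_bind, mults_pure, mults_rmul]
    -- The FFT calls coincide, so the saving is 2(N/2 - 1) in the loop plus the constants 2 and √2.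
    rw [mults_loop _ _ _ 2 fun j => by simp [cmulUnitReConj],
      mults_loop _ _ _ 4 fun j => by simp [cmulConj]]
    have : 0 < 2 ^ m := by positivity
    have := pow_succ 2 m
    omega

/-- The scaled algorithm uses the same number of additions. -/
theorem adds_scaledNsplitdctII (m : ℕ) (x : Fin (2 ^ m) → ℝ) :
    (scaledNsplitdctII m x).adds = (nsplitdctII m x).adds := by
  rcases m with _ | m
  · simp [scaledNsplitdctII, nsplitdctII]
  · simp only [scaledNsplitdctII, nsplitdctII, adds_bind, adds_pure, adds_rmul]
    rw [adds_loop _ _ _ 2 fun j => by simp [cmulUnitReConj],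
      adds_loop _ _ _ 2 fun j => by simp [cmulConj]]
    ring

/-- Control flow depends on the size only, so the count evaluates without computing any real number.
The FFT takes 22 flops, the three complex products 18, the outputs 0 and N/2 one each. -/
lemma flops_nsplitdctII_three (x : Fin (2 ^ 3) → ℝ) : (nsplitdctII 3 x).flops = 42 := by
  rfl

lemma flops_scaledNsplitdctII_three (x : Fin (2 ^ 3) → ℝ) :
    (scaledNsplitdctII 3 x).flops = 34 := by
  rfl

end ScaledDCT

theorem mainTheorem2 :
    (∀ (m : ℕ) (x : Fin (2 ^ m) → ℝ),
      (ScaledDCT.nsplitdctII m x).eval = ScaledDCT.dctII x ∧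
      (∀ k : Fin (2 ^ m), (ScaledDCT.scaledNsplitdctII m x).eval k =
        ScaledDCT.dctII x k / (2 * ScaledDCT.s (4 * 2 ^ m) k)) ∧
      (∀ k : Fin (2 ^ m), 0 < ScaledDCT.s (4 * 2 ^ m) k) ∧
      (ScaledDCT.scaledNsplitdctII m x).mults + 2 ^ m = (ScaledDCT.nsplitdctII m x).mults ∧
      (ScaledDCT.scaledNsplitdctII m x).adds = (ScaledDCT.nsplitdctII m x).adds) ∧
    (∀ x : Fin (2 ^ 3) → ℝ,
      (ScaledDCT.nsplitdctII 3 x).flops = 42 ∧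
      (ScaledDCT.scaledNsplitdctII 3 x).flops = 34) :=
  ⟨fun m x => ⟨ScaledDCT.eval_nsplitdctII m x, ScaledDCT.eval_scaledNsplitdctII m x,
    fun _ => ScaledDCT.s_pos _ _, ScaledDCT.mults_scaledNsplitdctII m x,
    ScaledDCT.adds_scaledNsplitdctII m x⟩,
    fun x => ⟨ScaledDCT.flops_nsplitdctII_three x, ScaledDCT.flops_scaledNsplitdctII_three x⟩⟩
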